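/- Let $K$ be an algebraically closed field and let $A$ be a (unital, associative) $K$-algebra of finite dimension and finite global dimension. Modules are left modules. For a $K$-linear category $\mathcal{C}$ with finitely many objects and finite-dimensional hom-spaces, let $Z_{\mathcal{C}}$ be the square matrix indexed by the objects, with entries $(Z_{\mathcal{C}})_{ab} = \dim_K \mathcal{C}(a,b)$; if $Z_{\mathcal{C}}$ is invertible over $\mathbb{Q}$, the magnitude $|\mathcal{C}|$ is the sum of all the entries of $Z_{\mathcal{C}}^{-1}$. More generally, the magnitude of a $K$-linear category $\mathcal{C}$ is defined if $\mathcal{C}$ is equivalent, as a $K$-linear category, to some such $\mathcal{B}$ with $Z_{\mathcal{B}}$ invertible, and then $|\mathcal{C}| = |\mathcal{B}|$ (this does not depend on $\mathcal{B}$). Write $\mathrm{IP}(A)$ for the $K$-linear category of indecomposable projective $A$-modules and all homomorphisms between them, let $(S_i)_{i \in I}$ be representatives of the isomorphism classes of simple $A$-modules, and put $S = \bigoplus_{i \in I} S_i$. Then every $\operatorname{Ext}^n_A(S,S)$ is finite-dimensional over $K$, only finitely many of these spaces are nonzero, the magnitude of $\mathrm{IP}(A)$ is defined, and $$|\mathrm{IP}(A)|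 = \chi_A(S,S) = \sum_{n=0}^{\infty} (-1)^n \dim_K \operatorname{Ext}^n_A(S,S).$$ -/

import Mathlib

open CategoryTheory

universe u v w

noncomputable section

/-! ### Magnitude of linear categories -/

/-- The square matrix `Z` of a `K`-linear category: rows and columns are indexed by the objects,
and the `(a, b)` entry is the dimension of the space of morphisms from `a` to `b`. -/
def homDimMatrix (K : Type u) [Field K] (B : Type w) [Category.{v} B] [Preadditive B]
    [Linear K B] : Matrix B B ℚ :=
  fun a b => (Module.finrank K (a ⟶ b) : ℚ)

open Classical in
/-- `IsMagnitude K C q`: the `K`-linear category `C` is equivalent, as a `K`-linear category, to a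
category `B` with finitely many objects and finite-dimensional morphism spaces whose matrix is
invertible, and `q` is the sum of all the entries of the inverse matrix.
(A category with finitely many objects which is equivalent to `C` may be taken to have its
objects in `Type` and its morphisms in the same universe as `C`.) -/
def IsMagnitude (K : Type u) [Field K] (C : Type w) [Category.{v} C] [Preadditive C]
    [Linear K C] (q : ℚ) : Prop :=
  ∃ (B : Type) (_ : Fintype B) (_ : Category.{v} B) (_ : Preadditive B) (_ : Linear K B)
    (e : B ≌ C),
    e.functor.Additive ∧ e.functor.Linear K ∧
    (∀ a b : B, Module.Finite K (a ⟶ b)) ∧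
    IsUnit (homDimMatrix K B) ∧
    q = ∑ a : B, ∑ b : B, (homDimMatrix K B)⁻¹ a b

/-- The magnitude of the `K`-linear category `C` is defined. -/
def MagnitudeDefined (K : Type u) [Field K] (C : Type w) [Category.{v} C] [Preadditive C]
    [Linear K C] : Prop :=
  ∃ q : ℚ, IsMagnitude K C q

open Classical in
/-- The magnitude of a `K`-linear category (with junk value `0` if it is not defined). -/
def magnitude (K : Type u) [Field K] (C : Type w) [Category.{v} C] [Preadditive C]
    [Linear K C] : ℚ :=
  if h : MagnitudeDefined K C then h.choose else 0

/-- Isomorphic objects index equal rows, so a category with invertible matrix is skeletal. -/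
theorem skeletal_of_isUnit_homDimMatrix {K : Type u} [Field K] {B : Type w} [Fintype B]
    [DecidableEq B] [Category.{v} B] [Preadditive B] [Linear K B]
    (h : IsUnit (homDimMatrix K B)) : Skeletal B := by
  intro a b hab
  obtain ⟨i⟩ := hab
  by_contra hne
  have hdet : (homDimMatrix K B).det = 0 := by
    refine Matrix.det_zero_of_row_eq hne ?_
    funext c
    simp only [homDimMatrix]
    rw [(Linear.homCongr K i (Iso.refl c)).finrank_eq]
  rw [Matrix.isUnit_iff_isUnit_det, hdet] at h
  exact not_isUnit_zero h

/-- The magnitude is well defined: it does not depend on the chosen finite category. -/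
theorem IsMagnitude.unique {K : Type u} [Field K] {C : Type w} [Category.{v} C] [Preadditive C]
    [Linear K C] {q q' : ℚ} (h : IsMagnitude K C q) (h' : IsMagnitude K C q') : q = q' := by
  classical
  obtain ⟨B, _, _, _, _, e, _, _, -, hu, rfl⟩ := h
  obtain ⟨B', _, _, _, _, e', _, _, -, hu', rfl⟩ := h'
  let f : B ≌ B' := e.trans e'.symm
  have hsk : Skeletal B := skeletal_of_isUnit_homDimMatrix (K := K) (by convert hu)
  have hsk' : Skeletal B' := skeletal_of_isUnit_homDimMatrix (K := K) (by convert hu')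
  let φ : B ≃ B' :=
    { toFun := f.functor.obj
      invFun := f.inverse.obj
      left_inv := fun x => hsk ⟨(f.unitIso.app x).symm⟩
      right_inv := fun x => hsk' ⟨f.counitIso.app x⟩ }
  have homEq {D : Type} [Category.{v} D] [Preadditive D] [Linear K D] (g : D ≌ C)
      [g.functor.Additive] [g.functor.Linear K] (a b : D) :
      Module.finrank K (a ⟶ b) = Module.finrank K (g.functor.obj a ⟶ g.functor.obj b) :=
    (LinearEquiv.ofBijective (g.functor.mapLinearMap K (X := a) (Y := b))
      ⟨g.functor.map_injective, g.functor.map_surjective⟩).finrank_eq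
  have hZ : homDimMatrix K B = (homDimMatrix K B').submatrix φ φ := by
    ext a b
    refine congrArg Nat.cast ?_
    exact (homEq e a b).trans ((Linear.homCongr K (e'.counitIso.app (e.functor.obj a))
      (e'.counitIso.app (e.functor.obj b))).finrank_eq.symm.trans (homEq e' (φ a) (φ b)).symm)
  have hinv : (homDimMatrix K B)⁻¹ = ((homDimMatrix K B')⁻¹).submatrix φ φ := by
    rw [hZ, Matrix.inv_submatrix_equiv]
  rw [hinv, ← φ.sum_comp]
  refine Finset.sum_congr rfl fun a _ => ?_
  rw [← φ.sum_comp]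
  rfl

theorem IsMagnitude.magnitude_eq {K : Type u} [Field K] {C : Type w} [Category.{v} C]
    [Preadditive C] [Linear K C] {q : ℚ} (h : IsMagnitude K C q) : magnitude K C = q := by
  have hd : MagnitudeDefined K C := ⟨q, h⟩
  rw [magnitude, dif_pos hd]
  exact hd.choose_spec.unique h

/-! ### Modules over an algebra -/

/-- Indecomposable projective (left) `A`-modules. -/
def isIndecProjective (A : Type v) [Ring A] : ObjectProperty (ModuleCat.{v} A) :=
  fun P => Indecomposable P ∧ Projective P

/-- The category of indecomposable projective `A`-modules and all homomorphisms between them.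
If `A` is a `K`-algebra, it is a `K`-linear category. -/
abbrev IndecProj (A : Type v) [Ring A] : Type (v + 1) :=
  (isIndecProjective A).FullSubcategory

/-- `A` has finite (left) global dimension: there is a uniform bound on the projective dimensions
of the `A`-modules. -/
def FiniteGlobalDimension (A : Type v) [Ring A] : Prop :=
  ∃ N : ℕ, ∀ X : ModuleCat.{v} A, HasProjectiveDimensionLE X N

/-- The family `S` consists of representatives of the isomorphism classes of simple `A`-modules:
each `S i` is simple, and each simple module is isomorphic to `S i` for exactly one `i`. -/
structure IsSimpleRepresentatives (A : Type v) [Ring A] {I : Type w}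
    (S : I → ModuleCat.{v} A) : Prop where
  simple : ∀ i, Simple (S i)
  existsUnique : ∀ T : ModuleCat.{v} A, Simple T → ∃! i, Nonempty (T ≅ S i)

/-- The Euler form `χ_A(X, Y) = ∑ₙ (-1)ⁿ dim Extⁿ_A(X, Y)`. -/
def eulerForm (K : Type u) [Field K] {A : Type v} [Ring A] [Algebra K A]
    (X Y : ModuleCat.{v} A) : ℤ :=
  ∑ᶠ n : ℕ, (-1 : ℤ) ^ n * (Module.finrank K (Abelian.Ext X Y n) : ℤ)

/-- The direct sum of a family of `A`-modules. -/
abbrev directSumModule {A : Type v} [Ring A] {I : Type v} (S : I → ModuleCat.{v} A) :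
    ModuleCat.{v} A :=
  ModuleCat.of A (DirectSum I fun i => S i)

end

open Limits Module

/-! ### Dimension counts along exact sequences. -/

section Linear

variable {K : Type u} [Field K] {C : Type w} [Category.{v} C] [Abelian C] [Linear K C]

/-! Let `P i` be the projective cover of `S i`; up to isomorphism these are exactly the
indecomposable projectives. As `K` is algebraically closed, `dim Hom(P i, S j) = δ_ij`, so `dim
Hom(P i, M)` counts the composition factors of `M` isomorphic to `S i`. Finite global dimension
makes `χ` additive in its first argument, hence `χ(M, Y) = ∑ i, dim Hom(P i, M) * χ(S i, Y)`
(`eulerForm_eq_sum_finrank_mul`).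

Since `χ(P j, Y) = dim Hom(P j, Y)`, taking `M = P j` and `Y = S k` shows that the transposed Cartan
matrix `Z` has inverse `(χ(S i, S k))`. With `Y = S`, where `S` is the sum of the simples, the row
vector `e i = χ(S i, S)` satisfies `e Z = (1, ..., 1)`, so its entries add up to the sum of the
entries of `Z⁻¹`. With `M = Y = S` they add up to `χ(S, S)`. -/

theorem finrank_eq_of_exact {U V W : Type*} [AddCommGroup U] [AddCommGroup V] [AddCommGroup W]
    [Module K U] [Module K V] [Module K W] [Module.Finite K V]
    (f : U →ₗ[K] V) (g : V →ₗ[K] W) (h : Function.Exact f g) :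
    finrank K V = finrank K (LinearMap.range f) + finrank K (LinearMap.range g) := by
  rw [← LinearMap.finrank_range_add_finrank_ker g, h.linearMap_ker_eq, add_comm]

/-- The functor of morphisms from a projective object is additive on dimensions. -/
theorem finrank_hom_projective_of_shortExact (P : C) [Projective P] {T : ShortComplex C}
    (hT : T.ShortExact) [Module.Finite K (P ⟶ T.X₁)] [Module.Finite K (P ⟶ T.X₂)] :
    finrank K (P ⟶ T.X₂) = finrank K (P ⟶ T.X₁) + finrank K (P ⟶ T.X₃) := by
  have := hT.mono_f
  have := hT.epi_g
  have hex : Function.Exact (Linear.rightComp K P T.f) (Linear.rightComp K P T.g) := by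
    intro x
    constructor
    · intro hx
      exact ⟨hT.exact.lift x hx, hT.exact.lift_f x hx⟩
    · rintro ⟨y, rfl⟩
      simp
  rw [finrank_eq_of_exact _ _ hex, LinearMap.finrank_range_of_inj, LinearMap.range_eq_top.2,
    finrank_top]
  · intro x
    exact ⟨Projective.factorThru x T.g, by simp⟩
  · intro x y hxy
    simpa [cancel_mono] using hxy

end Linear

/-! ### Additivity of Euler characteristics of Ext. -/

section Ext

open Abelian

variable (K : Type u) [Field K] {C : Type*} [Category* C] [Abelian C] [Linear K C] [HasExt.{w} C]

/-- Dimension bookkeeping in the contravariant long exact sequence; `d n` is the rank of the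
`n`-th connecting map. -/
theorem exists_finrank_ext_add_eq (Y : C) {T : ShortComplex C} (hT : T.ShortExact)
    (h₁ : ∀ n, Module.Finite K (Ext T.X₁ Y n)) (h₂ : ∀ n, Module.Finite K (Ext T.X₂ Y n))
    (h₃ : ∀ n, Module.Finite K (Ext T.X₃ Y n)) :
    ∃ d : ℕ → ℕ, (∀ n, d n ≤ finrank K (Ext T.X₁ Y n)) ∧
      finrank K (Ext T.X₂ Y 0) + d 0 = finrank K (Ext T.X₃ Y 0) + finrank K (Ext T.X₁ Y 0) ∧
      ∀ n, finrank K (Ext T.X₂ Y (n + 1)) + d n + d (n + 1) =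
        finrank K (Ext T.X₃ Y (n + 1)) + finrank K (Ext T.X₁ Y (n + 1)) := by
  have := hT.mono_f
  have := hT.epi_g
  let G n := (Ext.mk₀ T.g).precompOfLinear K Y (zero_add n)
  let F n := (Ext.mk₀ T.f).precompOfLinear K Y (zero_add n)
  let D n := hT.extClass.precompOfLinear K Y (add_comm 1 n)
  have e₂ n : Function.Exact (G n) (F n) :=
    (ShortComplex.ab_exact_iff_function_exact _).1 (Ext.contravariant_sequence_exact₂' hT Y n)
  have e₁ n : Function.Exact (F n) (D n) :=
    (ShortComplex.ab_exact_iff_function_exact _).1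
      (Ext.contravariant_sequence_exact₁' hT Y n (n + 1) (add_comm 1 n))
  have e₃ n : Function.Exact (D n) (G (n + 1)) :=
    (ShortComplex.ab_exact_iff_function_exact _).1
      (Ext.contravariant_sequence_exact₃' hT Y n (n + 1) (add_comm 1 n))
  refine ⟨fun n => finrank K (LinearMap.range (D n)), fun n => LinearMap.finrank_range_le _, ?_,
    fun n => ?_⟩
  · have a := finrank_eq_of_exact _ _ (e₂ 0)
    have b := finrank_eq_of_exact _ _ (e₁ 0)
    have c : finrank K (LinearMap.range (G 0)) = finrank K (Ext T.X₃ Y 0) :=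
      LinearMap.finrank_range_of_inj (Ext.precomp_mk₀_injective_of_epi Y T.g)
    lia
  · have a := finrank_eq_of_exact _ _ (e₂ (n + 1))
    have b := finrank_eq_of_exact _ _ (e₁ (n + 1))
    have c := finrank_eq_of_exact _ _ (e₃ n)
    lia

/-- The truncated Euler characteristic is additive on short exact sequences, as soon as the last
connecting map vanishes. -/
theorem sum_neg_one_pow_finrank_ext (Y : C) {T : ShortComplex C} (hT : T.ShortExact)
    (h₁ : ∀ n, Module.Finite K (Ext T.X₁ Y n)) (h₂ : ∀ n, Module.Finite K (Ext T.X₂ Y n))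
    (h₃ : ∀ n, Module.Finite K (Ext T.X₃ Y n)) (N : ℕ) (hN : Subsingleton (Ext T.X₁ Y N)) :
    ∑ n ∈ Finset.range (N + 1), (-1 : ℤ) ^ n * finrank K (Ext T.X₂ Y n) =
      ∑ n ∈ Finset.range (N + 1), (-1 : ℤ) ^ n * finrank K (Ext T.X₁ Y n) +
      ∑ n ∈ Finset.range (N + 1), (-1 : ℤ) ^ n * finrank K (Ext T.X₃ Y n) := by
  obtain ⟨d, hd, h0, hs⟩ := exists_finrank_ext_add_eq K Y hT h₁ h₂ h₃
  -- Truncating the long exact sequence at degree `m` leaves only the rank of the last connecting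
  -- map as error.
  have key : ∀ m : ℕ, ∑ n ∈ Finset.range (m + 1), (-1 : ℤ) ^ n * finrank K (Ext T.X₂ Y n)
      + (-1) ^ m * d m =
      ∑ n ∈ Finset.range (m + 1), (-1 : ℤ) ^ n * finrank K (Ext T.X₁ Y n) +
      ∑ n ∈ Finset.range (m + 1), (-1 : ℤ) ^ n * finrank K (Ext T.X₃ Y n) := by
    intro m
    induction m with
    | zero => simp only [zero_add, Finset.sum_range_one, pow_zero, one_mul]; lia
    | succ m ih =>
      rw [Finset.sum_range_succ, Finset.sum_range_succ _ (m + 1), Finset.sum_range_succ _ (m + 1)]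
      have hm : (finrank K (Ext T.X₂ Y (m + 1)) : ℤ) + d m + d (m + 1) =
        finrank K (Ext T.X₃ Y (m + 1)) + finrank K (Ext T.X₁ Y (m + 1)) := by exact_mod_cast hs m
      linear_combination ih + (-1) ^ (m + 1) * hm
  have hdN : d N = 0 := by
    have := hd N
    rwa [finrank_zero_of_subsingleton, Nat.le_zero] at this
  simpa [hdN] using key N

end Ext

/-! ### Projective covers of simple objects. -/

section Cover

variable {C : Type w} [Category.{v} C] [Abelian C]

/-- A projective cover of a simple object: a nonzero map from a projective object such that each
endomorphism over the simple object is invertible. -/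
structure IsSimpleCover {P S : C} (p : P ⟶ S) : Prop where
  projective : Projective P
  ne_zero : p ≠ 0
  isIso : ∀ f : P ⟶ P, f ≫ p = p → IsIso f

namespace IsSimpleCover

variable {P S : C} {p : P ⟶ S} [Simple S] (hp : IsSimpleCover p)
include hp

/-- A nonzero map to a simple object is epi, so `p` lifts through `f ≫ p`; the lift followed by `f`
is an endomorphism over `S`. In particular `f` is a split epimorphism. -/
theorem exists_isIso_comp {Y : C} (f : Y ⟶ P) (hf : f ≫ p ≠ 0) : ∃ g : P ⟶ Y, IsIso (g ≫ f) := by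
  have := hp.projective
  have : Epi (f ≫ p) := epi_of_nonzero_to_simple hf
  exact ⟨Projective.factorThru p (f ≫ p), hp.isIso _ (by simp)⟩

theorem indecomposable : Indecomposable P := by
  refine ⟨fun h => hp.ne_zero (h.eq_of_src _ _), fun Y Z e => ?_⟩
  -- A summand on which `p` is nonzero already surjects onto `P`, which kills the other projection.
  have aux : biprod.inl ≫ e.inv ≫ p ≠ 0 ∨ biprod.inr ≫ e.inv ≫ p ≠ 0 := by
    by_contra! h
    refine hp.ne_zero ?_
    rw [← cancel_epi e.inv, comp_zero]
    ext <;> simp [h]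
  rcases aux with h | h
  · obtain ⟨g, hg⟩ := hp.exists_isIso_comp (biprod.inl ≫ e.inv) (by simpa using h)
    have : Epi (biprod.inl ≫ e.inv) := epi_of_epi g _
    right
    have h0 : e.hom ≫ (biprod.snd : Y ⊞ Z ⟶ Z) = 0 := by
      rw [← cancel_epi (biprod.inl ≫ e.inv)]; simp
    rw [IsZero.iff_id_eq_zero, ← cancel_epi (e.hom ≫ biprod.snd)]
    simp [h0]
  · obtain ⟨g, hg⟩ := hp.exists_isIso_comp (biprod.inr ≫ e.inv) (by simpa using h)
    have : Epi (biprod.inr ≫ e.inv) := epi_of_epi g _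
    left
    have h0 : e.hom ≫ (biprod.fst : Y ⊞ Z ⟶ Y) = 0 := by
      rw [← cancel_epi (biprod.inr ≫ e.inv)]; simp
    rw [IsZero.iff_id_eq_zero, ← cancel_epi (e.hom ≫ biprod.fst)]
    simp [h0]

theorem nonempty_iso_of_indecomposable {Q : C} [Projective Q] (hQ : Indecomposable Q) (q : Q ⟶ S)
    (hq : q ≠ 0) : Nonempty (P ≅ Q) := by
  have := hp.projective
  have : Epi p := epi_of_nonzero_to_simple hp.ne_zero
  -- Lifting `q` through `p` exhibits `P` as a direct summand of `Q`.
  obtain ⟨g, hg⟩ := hp.exists_isIso_comp (Projective.factorThru q p) (by simpa)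
  set h := Projective.factorThru q p
  have : IsSplitMono g := IsSplitMono.mk' ⟨h ≫ inv (g ≫ h), by
    rw [← Category.assoc, IsIso.hom_inv_id]⟩
  have b := isBilimitBinaryBiconeOfIsSplitMonoOfCokernel (cokernelIsCokernel g)
  have e : Q ≅ P ⊞ cokernel g := biprod.uniqueUpToIso _ _ b
  rcases hQ.2 _ _ e with h0 | h0
  · exact (hp.ne_zero (h0.eq_of_src _ _)).elim
  · have : Epi g := Preadditive.epi_of_cokernel_zero (h0.eq_of_tgt _ _)
    have := isIso_of_mono_of_epi g
    exact ⟨asIso g⟩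

theorem exists_iso_of_ne_zero {T : C} [Simple T] (q : P ⟶ T) (hq : q ≠ 0) :
    ∃ e : S ≅ T, p ≫ e.hom = q := by
  have : Epi q := epi_of_nonzero_to_simple hq
  -- Otherwise the kernel of `q` would surject onto `P`, forcing `q = 0`.
  have hk : kernel.ι q ≫ p = 0 := by
    by_contra hk
    obtain ⟨g, hg⟩ := hp.exists_isIso_comp _ hk
    have : Epi (kernel.ι q) := epi_of_epi g _
    exact hq (by rw [← cancel_epi (kernel.ι q)]; simp)
  let r : T ⟶ S := Abelian.epiDesc q p hk
  have hr : q ≫ r = p := Abelian.comp_epiDesc q p hk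
  have hr0 : r ≠ 0 := by
    intro h
    exact hp.ne_zero (by rw [← hr, h, comp_zero])
  have := isIso_of_hom_simple hr0
  exact ⟨(asIso r).symm, by simp [← hr]⟩

theorem finrank_hom_eq_one (K : Type u) [Field K] [IsAlgClosed K] [Linear K C]
    [Module.Finite K (S ⟶ S)] : finrank K (P ⟶ S) = 1 := by
  have : Epi p := epi_of_nonzero_to_simple hp.ne_zero
  rw [← finrank_endomorphism_simple_eq_one K S]
  refine (LinearEquiv.ofBijective (Linear.leftComp K S p) ⟨fun x y hxy => ?_, fun y => ?_⟩
    ).finrank_eq.symm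
  · simpa [cancel_epi] using hxy
  · by_cases hy : y = 0
    · exact ⟨0, by simp [hy]⟩
    · obtain ⟨e, he⟩ := hp.exists_iso_of_ne_zero y hy
      exact ⟨e.hom, he⟩

theorem finrank_hom_eq_zero (K : Type u) [Field K] [Linear K C] {T : C} [Simple T]
    (h : IsEmpty (S ≅ T)) : finrank K (P ⟶ T) = 0 := by
  have : Subsingleton (P ⟶ T) := subsingleton_of_forall_eq 0 fun q => by
    by_contra hq
    exact h.elim (hp.exists_iso_of_ne_zero q hq).choose
  exact finrank_zero_of_subsingleton

end IsSimpleCover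

end Cover

/-! ### Modules over artinian rings. -/

section Modules

variable {A : Type v} [Ring A]

/-- The image of `f` is a nonzero left ideal, hence has a maximal submodule. `Q` itself need not be
finitely generated. -/
theorem exists_simple_quotient_of_ne_zero [IsNoetherianRing A] {Q : ModuleCat.{v} A}
    (f : Q ⟶ ModuleCat.of A A) (hf : f ≠ 0) :
    ∃ (T : ModuleCat.{v} A) (q : Q ⟶ T), Simple T ∧ q ≠ 0 := by
  let N := LinearMap.range f.hom
  obtain ⟨x, hx⟩ : ∃ x, f.hom x ≠ 0 := by
    by_contra! h
    exact hf (by ext x; exact h x)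
  have : Nontrivial N := ⟨⟨⟨f.hom x, x, rfl⟩, 0, by simpa [Subtype.ext_iff] using hx⟩⟩
  obtain ⟨M, hM, -⟩ := (eq_top_or_exists_le_coatom (⊥ : Submodule A N)).resolve_left bot_ne_top
  have hs : IsSimpleModule A (N ⧸ M) := isSimpleModule_iff_isCoatom.2 hM
  refine ⟨ModuleCat.of A (N ⧸ M), ModuleCat.ofHom (M.mkQ ∘ₗ f.hom.rangeRestrict),
    simple_iff_isSimpleModule.2 hs, fun h => hM.1 ?_⟩
  rw [eq_top_iff]
  rintro ⟨_, y, rfl⟩ -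
  have := congrArg (fun g => g.hom y) h
  exact (Submodule.Quotient.mk_eq_zero M).1 this

/-- A projective module embeds in a free one, where some coordinate is nonzero. -/
theorem exists_hom_ne_zero_of_projective (Q : ModuleCat.{v} A) [Projective Q] (hQ : ¬ IsZero Q) :
    ∃ f : Q ⟶ ModuleCat.of A A, f ≠ 0 := by
  have hp : Module.Projective A Q := (IsProjective.iff_projective Q).2 ‹_›
  obtain ⟨s, hs⟩ := hp.out
  rw [ModuleCat.isZero_iff_subsingleton, not_subsingleton_iff_nontrivial] at hQ
  obtain ⟨x, hx⟩ := exists_ne (0 : Q)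
  have : s x ≠ 0 := fun h => hx (by rw [← hs x, h, map_zero])
  obtain ⟨y, hy⟩ := Finsupp.ne_iff.1 this
  refine ⟨ModuleCat.ofHom (Finsupp.lapply y ∘ₗ s), fun h => hy ?_⟩
  exact congrArg (fun g => g.hom x) h

/-- Every simple module over an artinian ring has a finitely generated projective cover. -/
theorem exists_isSimpleCover [IsArtinianRing A] (S : ModuleCat.{v} A) [Simple S] :
    ∃ (P : ModuleCat.{v} A) (p : P ⟶ S), Module.Finite A P ∧ IsSimpleCover p := by
  -- The cover is a minimal member of this set of left ideals.
  let F : Set (Submodule A A) := {N | Module.Projective A N ∧ ∃ g : N →ₗ[A] S, g ≠ 0}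
  have hF : F.Nonempty := by
    have : IsSimpleModule A S := (simple_iff_isSimpleModule' S).1 inferInstance
    have := IsSimpleModule.nontrivial A S
    obtain ⟨x, hx⟩ := exists_ne (0 : S)
    refine ⟨⊤, Module.Projective.of_equiv Submodule.topEquiv.symm,
      LinearMap.toSpanSingleton A S x ∘ₗ (⊤ : Submodule A A).subtype, fun h => hx ?_⟩
    simpa using congrArg (fun g => g ⟨1, trivial⟩) h
  obtain ⟨N, ⟨hN, g, hg⟩, hmin⟩ := IsArtinian.set_has_minimal F hF
  refine ⟨ModuleCat.of A N, ModuleCat.ofHom g, inferInstanceAs (Module.Finite A N),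
    (IsProjective.iff_projective N).1 hN, fun h => hg (by simpa using congrArg (·.hom) h),
    fun f hf => ?_⟩
  let φ : Module.End A N := f.hom
  have hφ : g ∘ₗ φ = g := congrArg (·.hom) hf
  obtain ⟨n, hn⟩ := Filter.eventually_atTop.1 φ.eventually_isCompl_ker_pow_range_pow
  -- Fitting's lemma: the image of a high power of `φ` is a direct summand. It still maps
  -- nontrivially to `S`, so minimality makes it all of `N`. A positive exponent lets one factor `φ`
  -- be split off at the end.
  have hc := hn (n + 1) (by lia)
  have hpow : ∀ k, g ∘ₗ (φ ^ k) = g := by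
    intro k
    induction k with
    | zero => rfl
    | succ k ih => rw [pow_succ', Module.End.mul_eq_comp, ← LinearMap.comp_assoc, hφ, ih]
  have hR : LinearMap.range (φ ^ (n + 1)) = ⊤ := by
    set R := LinearMap.range (φ ^ (n + 1))
    have hRp : Module.Projective A R := by
      refine Module.Projective.of_split R.subtype (R.projectionOnto _ hc.symm) ?_
      ext x
      simp
    let e : R ≃ₗ[A] R.map N.subtype := R.equivMapOfInjective _ N.injective_subtype
    have hmem : R.map N.subtype ∈ F := by
      refine ⟨Module.Projective.of_equiv e, g ∘ₗ R.subtype ∘ₗ e.symm.toLinearMap, fun h => hg ?_⟩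
      ext x
      have := congrArg (fun t => t (e ⟨(φ ^ (n + 1)) x, x, rfl⟩)) h
      simp only [LinearMap.comp_apply, LinearEquiv.coe_coe, LinearEquiv.symm_apply_apply,
        Submodule.subtype_apply, LinearMap.zero_apply] at this
      rw [← hpow (n + 1)]
      exact this
    have hle : R.map N.subtype ≤ N := Submodule.map_subtype_le N R
    have heq : R.map N.subtype = N := by
      by_contra hne
      exact hmin _ hmem (lt_of_le_of_ne hle hne)
    apply Submodule.map_injective_of_injective N.injective_subtype
    rw [heq, Submodule.map_top, Submodule.range_subtype]
  have hK : LinearMap.ker (φ ^ (n + 1)) = ⊥ := by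
    have := hc.disjoint
    rwa [hR, disjoint_top] at this
  rw [ConcreteCategory.isIso_iff_bijective]
  constructor
  · rw [pow_succ] at hK
    have h := LinearMap.ker_eq_bot.1 hK
    rw [Module.End.coe_mul] at h
    exact h.of_comp
  · rw [pow_succ'] at hR
    have h := LinearMap.range_eq_top.1 hR
    rw [Module.End.coe_mul] at h
    exact h.of_comp

/-- Finitely generated modules over an artinian ring are iterated extensions of simple modules. -/
theorem induction_on_simple_quotient [IsArtinianRing A] {I : Type w} {S : I → ModuleCat.{v} A}
    (hS : IsSimpleRepresentatives A S) (motive : ModuleCat.{v} A → Prop)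
    (zero : ∀ M : ModuleCat.{v} A, IsZero M → motive M)
    (step : ∀ (T : ShortComplex (ModuleCat.{v} A)) (i : I) (_ : T.X₃ ≅ S i), T.ShortExact →
      Module.Finite A T.X₁ → Module.Finite A T.X₂ → motive T.X₁ → motive T.X₂)
    (M : ModuleCat.{v} A) [Module.Finite A M] : motive M := by
  have hM : IsFiniteLength A M := isFiniteLength_iff_isNoetherian_isArtinian.2
    ⟨inferInstance, inferInstance⟩
  have key : ∀ (X : Type v) [AddCommGroup X] [Module A X], IsFiniteLength A X →
      Module.Finite A X → motive (ModuleCat.of A X) := by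
    intro X _ _ hX
    induction hX with
    | of_subsingleton => exact fun _ => zero _ (ModuleCat.isZero_of_subsingleton _)
    | @of_simple_quotient X _ _ N hs _ ih =>
      intro hfin
      have hsi : Simple (ModuleCat.of A (X ⧸ N)) := simple_iff_isSimpleModule.2 hs
      obtain ⟨i, ⟨e⟩, -⟩ := hS.existsUnique _ hsi
      exact step (ShortComplex.mk (ModuleCat.ofHom N.subtype) (ModuleCat.ofHom N.mkQ)
        (by ext x; simp)) i e
        { exact := (ShortComplex.ShortExact.moduleCat_exact_iff_function_exact _).2
            (LinearMap.exact_subtype_mkQ N)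
          mono_f := (ModuleCat.mono_iff_injective _).2 N.injective_subtype
          epi_g := (ModuleCat.epi_iff_surjective _).2 N.mkQ_surjective }
        (inferInstance : Module.Finite A N) hfin (ih inferInstance)
  exact key M hM inferInstance

end Modules

/-! ### The Euler form over a finite-dimensional algebra. -/

section Algebra

open Abelian

variable {K : Type u} [Field K] {A : Type v} [Ring A] [Algebra K A]

theorem eulerForm_eq_sum (X Y : ModuleCat.{v} A) (N : ℕ)
    (hN : ∀ n, N ≤ n → Subsingleton (Ext X Y n)) :
    eulerForm K X Y = ∑ n ∈ Finset.range N, (-1 : ℤ) ^ n * finrank K (Ext X Y n) := by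
  refine finsum_eq_sum_of_support_subset _ fun n hn => ?_
  by_contra h
  have := hN n (by simpa using h)
  exact hn (by simp [finrank_zero_of_subsingleton])

theorem eulerForm_of_projective (P Y : ModuleCat.{v} A) [Projective P] :
    eulerForm K P Y = finrank K (P ⟶ Y) := by
  rw [eulerForm_eq_sum P Y 1 fun n hn => ?_]
  · simp [(Ext.linearEquiv₀ (R := K) (X := P) (Y := Y)).finrank_eq]
  · obtain ⟨m, rfl⟩ := Nat.exists_eq_add_of_le' hn
    exact Ext.subsingleton_of_projective P Y m

theorem eulerForm_of_isZero (X Y : ModuleCat.{v} A) (hX : IsZero X) : eulerForm K X Y = 0 := by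
  have := hX.hasProjectiveDimensionLT_zero
  rw [eulerForm_eq_sum X Y 0 fun n hn => HasProjectiveDimensionLT.subsingleton X 0 n hn Y]
  simp

variable [Module.Finite K A]

theorem finite_hom (X Y : ModuleCat.{v} A) [Module.Finite A X] [Module.Finite A Y] :
    Module.Finite K (X ⟶ Y) := by
  let := Module.restrictScalars K A Y
  have := IsScalarTower.restrictScalars K A Y
  have : Module.Finite K Y := Module.Finite.trans A Y
  obtain ⟨n, s, hs⟩ := Module.Finite.exists_fin (R := A) (M := X)
  let φ : (X ⟶ Y) →ₗ[K] (Fin n → Y) :=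
    { toFun f i := f.hom (s i)
      map_add' _ _ := rfl
      map_smul' _ _ := rfl }
  refine Module.Finite.of_injective φ fun f g h => ?_
  ext1
  exact LinearMap.ext_on_range hs (congrFun h)

/-- Dimension shifting along a finite free presentation. -/
theorem finite_ext (X Y : ModuleCat.{v} A) [Module.Finite A X] [Module.Finite A Y] (n : ℕ) :
    Module.Finite K (Ext X Y n) := by
  have : IsNoetherianRing A := IsNoetherianRing.of_finite K A
  induction n generalizing X with
  | zero =>
    have := finite_hom (K := K) X Y
    exact Module.Finite.equiv Ext.linearEquiv₀.symm
  | succ n ih =>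
    obtain ⟨m, f, hf⟩ := Module.Finite.exists_fin' A X
    let T := f.shortComplexKer
    have hT : T.ShortExact := LinearMap.shortExact_shortComplexKer hf
    have h₁ : Module.Finite A T.X₁ := inferInstanceAs (Module.Finite A (LinearMap.ker f))
    have h₂ : Projective T.X₂ := (IsProjective.iff_projective (Fin m → A)).1 inferInstance
    have := ih T.X₁
    exact Module.Finite.of_surjective (hT.extClass.precompOfLinear K Y (add_comm 1 n))
      fun x => Ext.contravariant_sequence_exact₃ hT Y x (Ext.eq_zero_of_projective _)
        (add_comm 1 n)

theorem eulerForm_of_shortExact (hA : FiniteGlobalDimension A) (Y : ModuleCat.{v} A)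
    [Module.Finite A Y] {T : ShortComplex (ModuleCat.{v} A)} (hT : T.ShortExact)
    (h₁ : Module.Finite A T.X₁) (h₂ : Module.Finite A T.X₂) (h₃ : Module.Finite A T.X₃) :
    eulerForm K T.X₂ Y = eulerForm K T.X₁ Y + eulerForm K T.X₃ Y := by
  obtain ⟨N, hN⟩ := hA
  -- Ext vanishes from degree `N + 1` on; the sums keep that degree so that the last connecting map
  -- starts at a zero space.
  have h X n (hn : N + 2 ≤ n) : Subsingleton (Ext X Y n) :=
    have := hN X
    HasProjectiveDimensionLT.subsingleton X (N + 1) n (by lia) Y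
  rw [eulerForm_eq_sum _ _ _ (h T.X₁), eulerForm_eq_sum _ _ _ (h T.X₂),
    eulerForm_eq_sum _ _ _ (h T.X₃)]
  exact sum_neg_one_pow_finrank_ext K Y hT (finite_ext _ _) (finite_ext _ _) (finite_ext _ _)
    (N + 1) (have := hN T.X₁; HasProjectiveDimensionLT.subsingleton T.X₁ (N + 1) _ le_rfl Y)

theorem eulerForm_congr_left (hA : FiniteGlobalDimension A) {X X' : ModuleCat.{v} A} (e : X ≅ X')
    (Y : ModuleCat.{v} A) [Module.Finite A X] [Module.Finite A X'] [Module.Finite A Y] :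
    eulerForm K X Y = eulerForm K X' Y := by
  -- Additivity is applied to `0 → X → X' → 0 → 0`.
  let T := ShortComplex.mk e.hom (0 : X' ⟶ ModuleCat.of A PUnit) comp_zero
  have hz : IsZero (ModuleCat.of A PUnit.{v + 1}) := ModuleCat.isZero_of_subsingleton _
  have hT : T.ShortExact :=
    { exact := (ShortComplex.exact_iff_epi T rfl).2 (inferInstanceAs (Epi e.hom))
      mono_f := inferInstanceAs (Mono e.hom)
      epi_g := ⟨fun _ _ _ => hz.eq_of_src _ _⟩ }
  have := eulerForm_of_shortExact (K := K) hA Y hT ‹_› ‹_›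
    (inferInstance : Module.Finite A PUnit.{v + 1})
  rw [eulerForm_of_isZero T.X₃ Y hz, add_zero] at this
  exact this.symm

end Algebra

/-! ### The Cartan matrix and the magnitude. -/

section Magnitude

open Abelian

variable {K : Type u} [Field K] {A : Type v} [Ring A] [Algebra K A] [Module.Finite K A]

theorem IsSimpleRepresentatives.module_finite {I : Type w} {S : I → ModuleCat.{v} A}
    (hS : IsSimpleRepresentatives A S) (i : I) : Module.Finite A (S i) := by
  have := (simple_iff_isSimpleModule' (S i)).1 (hS.simple i)
  infer_instance

theorem IsSimpleRepresentatives.eq_of_iso {I : Type w} {S : I → ModuleCat.{v} A}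
    (hS : IsSimpleRepresentatives A S) {i j : I} (e : S i ≅ S j) : i = j :=
  (hS.existsUnique _ (hS.simple i)).unique ⟨Iso.refl _⟩ ⟨e⟩

theorem finrank_hom_directSumModule {I : Type v} [Fintype I] (S : I → ModuleCat.{v} A)
    (P : ModuleCat.{v} A) [Module.Finite A P] [∀ i, Module.Finite A (S i)] :
    finrank K (P ⟶ directSumModule S) = ∑ i, finrank K (P ⟶ S i) := by
  classical
  have (i : I) : Module.Finite K (P ⟶ S i) := finite_hom _ _
  let e := DirectSum.linearEquivFunOnFintype A I fun i => S i
  let φ : (P ⟶ directSumModule S) ≃ₗ[K] ((i : I) → (P ⟶ S i)) :=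
    { toFun f i := ModuleCat.ofHom (LinearMap.proj i ∘ₗ e.toLinearMap ∘ₗ f.hom)
      invFun g := ModuleCat.ofHom (e.symm.toLinearMap ∘ₗ LinearMap.pi fun i => (g i).hom)
      map_add' _ _ := rfl
      map_smul' c f := by
        ext i x
        exact congrFun (map_smul e (algebraMap K A c) (f.hom x)) i
      left_inv f := by
        ext x : 2
        exact e.symm_apply_apply _
      right_inv g := by
        ext i x
        exact congrFun (e.apply_symm_apply _) i }
  rw [φ.finrank_eq, finrank_pi_fintype]

variable {I : Type v} {S P : I → ModuleCat.{v} A} (hS : IsSimpleRepresentatives A S)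
  {p : ∀ i, P i ⟶ S i} (hp : ∀ i, IsSimpleCover (p i))
include hS hp

theorem finrank_hom_cover [IsAlgClosed K] [DecidableEq I] (i j : I) :
    finrank K (P i ⟶ S j) = if i = j then 1 else 0 := by
  have := hS.simple i
  have := hS.simple j
  have := hS.module_finite i
  split_ifs with h
  · subst h
    have := finite_hom (K := K) (S i) (S i)
    exact (hp i).finrank_hom_eq_one K
  · exact (hp i).finrank_hom_eq_zero K ⟨fun e => h (hS.eq_of_iso e)⟩

/-- Each composition factor of `M` contributes at most one index. For `M = A` every index occurs,
which proves that there are finitely many simples. -/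
theorem finite_setOf_hom_ne_zero [IsArtinianRing A] (M : ModuleCat.{v} A) [Module.Finite A M] :
    {i | ∃ f : P i ⟶ M, f ≠ 0}.Finite := by
  induction M using induction_on_simple_quotient hS with
  | zero M hM =>
    refine Set.finite_empty.subset ?_
    rintro i ⟨f, hf⟩
    exact hf (hM.eq_of_tgt _ _)
  | step T j e hT _ _ ih =>
    refine (ih.union (Set.finite_singleton j)).subset ?_
    rintro i ⟨f, hf⟩
    have := hT.mono_f
    have := hS.simple i
    have := hS.simple j
    by_cases h : f ≫ T.g = 0
    · refine Or.inl ⟨hT.exact.lift f h, fun h0 => hf ?_⟩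
      rw [← hT.exact.lift_f f h, h0, zero_comp]
    · obtain ⟨e', -⟩ := (hp i).exists_iso_of_ne_zero (f ≫ T.g ≫ e.hom) fun h0 => h <| by
        rw [← cancel_mono e.hom, Category.assoc, h0, zero_comp]
      exact Or.inr (hS.eq_of_iso e')

theorem finite_index [IsArtinianRing A] : Finite I := by
  refine Set.finite_univ_iff.1
    ((finite_setOf_hom_ne_zero hS hp (ModuleCat.of A A)).subset fun i _ => ?_)
  have := (hp i).projective
  exact exists_hom_ne_zero_of_projective (P i) fun h => (hp i).ne_zero (h.eq_of_src _ _)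

/-- Both sides are additive in `M`, and they agree on simple modules because `dim Hom(P i, S j) =
δ_ij`. -/
theorem eulerForm_eq_sum_finrank_mul [IsAlgClosed K] [Fintype I] (hA : FiniteGlobalDimension A)
    (hP : ∀ i, Module.Finite A (P i)) (M Y : ModuleCat.{v} A) [Module.Finite A M]
    [Module.Finite A Y] :
    eulerForm K M Y = ∑ i, (finrank K (P i ⟶ M) : ℤ) * eulerForm K (S i) Y := by
  classical
  have : IsArtinianRing A := IsArtinianRing.of_finite K A
  induction M using induction_on_simple_quotient hS with
  | zero M hM =>
    have (i : I) : Subsingleton (P i ⟶ M) := ⟨fun _ _ => hM.eq_of_tgt _ _⟩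
    simp [eulerForm_of_isZero M Y hM, finrank_zero_of_subsingleton]
  | step T j e hT h₁ h₂ ih =>
    have := hS.module_finite j
    have h₃ : Module.Finite A T.X₃ := Module.Finite.equiv e.symm.toLinearEquiv
    have hr (i : I) : finrank K (P i ⟶ T.X₃) = if i = j then 1 else 0 := by
      rw [← finrank_hom_cover (K := K) hS hp, (Linear.homCongr K (Iso.refl (P i)) e).finrank_eq]
    have hd (i : I) := by
      have := (hp i).projective
      have := finite_hom (K := K) (P i) T.X₁
      have := finite_hom (K := K) (P i) T.X₂
      exact finrank_hom_projective_of_shortExact (K := K) (P i) hT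
    rw [eulerForm_of_shortExact hA Y hT h₁ h₂ h₃, eulerForm_congr_left hA e Y, ih]
    simp [hd, hr, add_mul, Finset.sum_add_distrib]

theorem exists_iso_cover_of_isIndecProjective [IsArtinianRing A] (Q : ModuleCat.{v} A)
    (hQ : isIndecProjective A Q) : ∃ i, Nonempty (P i ≅ Q) := by
  obtain ⟨hi, _⟩ := hQ
  obtain ⟨f, hf⟩ := exists_hom_ne_zero_of_projective Q hi.1
  obtain ⟨T, q, hT, hq⟩ := exists_simple_quotient_of_ne_zero f hf
  obtain ⟨i, ⟨e⟩, -⟩ := hS.existsUnique T hT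
  have := hS.simple i
  refine ⟨i, (hp i).nonempty_iso_of_indecomposable hi (q ≫ e.hom) fun h => hq ?_⟩
  rw [← cancel_mono e.hom, h, zero_comp]

/-- The magnitude of the category of indecomposable projective modules is the sum of the entries
of the inverse of the Cartan matrix. -/
theorem isMagnitude_indecProj [IsArtinianRing A] [Fintype I] [DecidableEq I]
    (hP : ∀ i, Module.Finite A (P i)) {Z : Matrix I I ℚ}
    (hZ : ∀ i j, Z i j = finrank K (P i ⟶ P j)) (hu : IsUnit Z) :
    IsMagnitude K (IndecProj A) (∑ i, ∑ j, Z⁻¹ i j) := by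
  have hind (i : I) : isIndecProjective A (P i) :=
    have := hS.simple i
    ⟨(hp i).indecomposable, (hp i).projective⟩
  let ε := Fintype.equivFin I
  -- `IsMagnitude` wants objects in `Type`, whereas `I` lives in `Type v`.
  let F : Fin (Fintype.card I) → IndecProj A := fun b => ⟨P (ε.symm b), hind _⟩
  let B : Type := InducedCategory (IndecProj A) F
  have : (inducedFunctor F).EssSurj := ⟨fun Q => by
    obtain ⟨i, ⟨e⟩⟩ := exists_iso_cover_of_isIndecProjective hS hp Q.obj Q.property
    refine ⟨ε i, ⟨(isIndecProjective A).isoMk ?_⟩⟩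
    exact eqToIso (congrArg P (ε.symm_apply_apply i)) ≪≫ e⟩
  have : (inducedFunctor F).IsEquivalence := { }
  let h (a b : B) : (a ⟶ b) ≃ₗ[K] (P (ε.symm a) ⟶ P (ε.symm b)) :=
    (InducedCategory.homLinearEquiv (R := K) (F := F)).trans
      (LinearEquiv.ofBijective ((isIndecProjective A).ι.mapLinearMap K (X := F a) (Y := F b))
        ⟨(isIndecProjective A).ι.map_injective, (isIndecProjective A).ι.map_surjective⟩)
  let : DecidableEq B := Classical.decEq B
  let σ : B ≃ I := ε.symm
  have hB : homDimMatrix K B = Z.submatrix σ σ := by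
    ext a b
    exact (congrArg Nat.cast (h a b).finrank_eq).trans (hZ _ _).symm
  let : Fintype B := (inferInstance : Fintype (Fin (Fintype.card I)))
  refine ⟨B, inferInstance, inferInstance, inferInstance, inferInstance,
    (inducedFunctor F).asEquivalence, inferInstanceAs (inducedFunctor F).Additive,
    inferInstanceAs ((inducedFunctor F).Linear K), fun a b => ?_, ?_, ?_⟩
  · have := finite_hom (K := K) (P (σ a)) (P (σ b))
    exact Module.Finite.equiv (h a b).symm
  · rw [hB]
    convert (Matrix.isUnit_submatrix_equiv (A := Z) σ σ).2 hu
  · rw [hB]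
    have hinv := Matrix.inv_submatrix_equiv Z σ σ
    trans ∑ a : B, ∑ b : B, Z⁻¹ (σ a) (σ b)
    · rw [← σ.sum_comp]
      refine Fintype.sum_congr _ _ fun a => ?_
      exact (σ.sum_comp fun j => Z⁻¹ (σ a) j).symm
    · refine Fintype.sum_congr _ _ fun a => Fintype.sum_congr _ _ fun b => ?_
      exact (congrFun (congrFun hinv a) b).symm.trans (by congr!)

end Magnitude

theorem theorem1 {K : Type u} [Field K] [IsAlgClosed K] {A : Type v} [Ring A] [Algebra K A]
    [Module.Finite K A] (hA : FiniteGlobalDimension A)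
    {I : Type v} (S : I → ModuleCat.{v} A) (hS : IsSimpleRepresentatives A S) :
    (∀ n : ℕ, Module.Finite K
      (Abelian.Ext (directSumModule S) (directSumModule S) n)) ∧
    (∃ N : ℕ, ∀ n : ℕ, N ≤ n →
      Subsingleton (Abelian.Ext (directSumModule S) (directSumModule S) n)) ∧
    MagnitudeDefined K (IndecProj A) ∧
    magnitude K (IndecProj A) = (eulerForm K (directSumModule S) (directSumModule S) : ℚ) := by
  classical
  have : IsArtinianRing A := IsArtinianRing.of_finite K A
  have hcov (i : I) := have := hS.simple i; exists_isSimpleCover (S i)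
  choose P p hP hp using hcov
  have := finite_index hS hp
  let := Fintype.ofFinite I
  have := hS.module_finite
  have hfin : Module.Finite A (directSumModule S) :=
    Module.Finite.equiv (DirectSum.linearEquivFunOnFintype A I fun i => S i).symm
  -- The expansion of `χ(M, Y)` at `M = P j`, where only degree zero survives.
  have hχ (j : I) (Y : ModuleCat.{v} A) [Module.Finite A Y] :
      (finrank K (P j ⟶ Y) : ℤ) =
        ∑ i, (finrank K (P i ⟶ P j) : ℤ) * eulerForm K (S i) Y := by
    have := (hp j).projective
    rw [← eulerForm_of_projective, eulerForm_eq_sum_finrank_mul hS hp hA hP]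
  have hone (j : I) : finrank K (P j ⟶ directSumModule S) = 1 := by
    simp [finrank_hom_directSumModule, finrank_hom_cover hS hp]
  let Z : Matrix I I ℚ := Matrix.of fun i j => (finrank K (P i ⟶ P j) : ℚ)
  let E : Matrix I I ℚ := Matrix.of fun i j => (eulerForm K (S i) (S j) : ℚ)
  have hZE : Z.transpose * E = 1 := by
    ext j k
    have := hχ j (S k)
    rw [finrank_hom_cover hS hp] at this
    rw [Matrix.mul_apply, Matrix.one_apply]
    simp only [Z, E, Matrix.transpose_apply, Matrix.of_apply]
    exact_mod_cast this.symm
  have hEZ : E.transpose * Z = 1 := by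
    rw [← Matrix.transpose_inj, Matrix.transpose_mul, Matrix.transpose_transpose, hZE,
      Matrix.transpose_one]
  have hu : IsUnit Z := IsUnit.of_mul_eq_one_right _ hEZ
  have hmag := isMagnitude_indecProj (K := K) hS hp hP (Z := Z) (fun _ _ => rfl) hu
  refine ⟨finite_ext _ _, ?_, ⟨_, hmag⟩, ?_⟩
  · obtain ⟨N, hN⟩ := hA
    have := hN (directSumModule S)
    exact ⟨N + 1, fun n hn => HasProjectiveDimensionLT.subsingleton _ (N + 1) n hn _⟩
  · rw [hmag.magnitude_eq]
    -- This is the weighting whose total is the magnitude.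
    let e : I → ℚ := fun i => eulerForm K (S i) (directSumModule S)
    have he : Matrix.vecMul e Z = 1 := by
      ext j
      have := hχ j (directSumModule S)
      rw [hone] at this
      simp only [Matrix.vecMul, dotProduct, Z, e, Matrix.of_apply, Pi.one_apply]
      simp only [mul_comm]
      exact_mod_cast this.symm
    have he' : e = Matrix.vecMul 1 Z⁻¹ := by
      rw [← he, Matrix.vecMul_vecMul, Matrix.mul_nonsing_inv _
        ((Matrix.isUnit_iff_isUnit_det Z).1 hu), Matrix.vecMul_one]
    have hsum : (eulerForm K (directSumModule S) (directSumModule S) : ℚ) = ∑ i, e i := by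
      rw [eulerForm_eq_sum_finrank_mul hS hp hA hP (directSumModule S)]
      simp [hone, e]
    rw [hsum, he']
    refine Finset.sum_comm.trans ?_
    simp [Matrix.vecMul, dotProduct]
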